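/- For $r\in\mathbb{N}$ let $U_r$ be the uniform distribution on $\{0,1\}^r$. Let $I\subseteq\mathbb{N}$ be an infinite set (of seed lengths) and $\ell\colon\mathbb{N}\to\mathbb{N}$. A *cryptographic PRNG* with seed lengths $I$ and length function $\ell$ is a deterministic algorithm $G$ from bit strings to bit strings such that, for every $m\in I$, one has $\ell(m)>m$ and $G(s)$ has length $\ell(m)$ for every seed $s$ of length $m$. It is *secure* if for every probabilistic polynomial-time algorithm $D$ (with one output bit), every positive polynomial $p$, and all sufficiently large $m\in I$, $$\bigl|\Pr[D(G(U_m))=1]-\Pr[D(U_{\ell(m)})=1]\bigr|<\frac1{p(m)},$$ the probabilities being taken over $U_m$, $U_{\ell(m)}$ and the internal coin tosses of $D$. Proposition. Let $k>2$ be an integer and let $H$ be a secure cryptographic PRNG whose seed lengths are all integers $N\ge 1$ and whose length function is $\ell_H(N)=kN$. Let $X$ be the map that, for every $N\geq 1$, sends a string $x_0S_0$ of length $2N$, with $x_0,S_0\in\{0,1\}^N$, to $$(x_0\oplus S_0\oplus S_1)\,(x_0\oplus S_0\oplus S_1\oplus S_2)\cdots\Bigl(x_0\oplus\bigoplus_{i=0}^{k}S_i\Bigr)\in\{0,1\}^{kN},$$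 where $H(S_0)=S_1\cdots S_k$ with $S_1,\dots,S_k\in\{0,1\}^N$, and $\oplus$ is the bitwise exclusive or. Then $X$ is a secure cryptographic PRNG, whose seed lengths are the even integers $2N\ge 2$ and whose length function is $\ell_X(2N)=kN$. -/

import Mathlib

open Filter Turing Computability

noncomputable section

namespace XorPRNG

/-- The uniform distribution `U_m` over the bit strings of length `m`. -/
def uniformBits (m : ℕ) : PMF (List Bool) :=
  (PMF.uniformOfFintype (Fin m → Bool)).map List.ofFn

/-- A probabilistic polynomial-time algorithm with one output bit: a deterministic polynomial-time
Turing machine reading the input `w` together with a string `r` of coin tosses, whose length is a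
polynomial in the length of `w`. The pair `(w, r)` is written on the input stack with the bits of
`w` and those of `r` in two disjoint copies of the binary alphabet. -/
structure PPT where
  /-- the number of coin tosses, as a polynomial in the input length -/
  coins : Polynomial ℕ
  /-- the output bit on the input `w` with the coin tosses `r` -/
  verdict : List Bool × List Bool → Bool
  polyTime : Nonempty (TM2ComputableInPolyTime
    (encodingProd (encodingList Bool) (encodingList Bool)).encode encodeBool verdict)

/-- The distribution of the output bit `D(w)`, over the internal coin tosses of `D`. -/
def PPT.run (D : PPT) (w : List Bool) : PMF Bool :=
  (uniformBits (D.coins.eval w.length)).map fun r => D.verdict (w, r)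

/-- `Pr[D(W) = 1]` for a random string `W` of distribution `μ`, over `W` and the coins of `D`. -/
def PPT.acceptProb (D : PPT) (μ : PMF (List Bool)) : ℝ :=
  ((μ.bind D.run) true).toReal

/-- `G` is a pseudorandom generator with the set `I` of seed lengths and the length function `ℓ`:
a deterministic algorithm that sends every seed of length `m ∈ I` to a string of length `ℓ m > m`.
The values of `G` on strings whose length is not in `I` are irrelevant. -/
structure IsPRNG (I : Set ℕ) (ℓ : ℕ → ℕ) (G : List Bool → List Bool) : Prop where
  computable : Computable G
  infinite : I.Infinite
  length_eq : ∀ s : List Bool, s.length ∈ I → (G s).length = ℓ s.length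
  stretch : ∀ m ∈ I, m < ℓ m

/-- Security: for every probabilistic polynomial-time `D`, every positive polynomial `p` and all
sufficiently large seed lengths `m`,
`|Pr[D(G(U_m)) = 1] - Pr[D(U_{ℓ(m)}) = 1]| < 1 / p(m)`. -/
def IsSecure (I : Set ℕ) (ℓ : ℕ → ℕ) (G : List Bool → List Bool) : Prop :=
  ∀ (D : PPT) (p : Polynomial ℝ), (∀ n : ℕ, 0 < p.eval (n : ℝ)) →
    ∀ᶠ m : ℕ in atTop, m ∈ I →
      |D.acceptProb ((uniformBits m).map G) - D.acceptProb (uniformBits (ℓ m))|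
        < 1 / p.eval (m : ℝ)

/-- A secure pseudorandom generator. -/
def IsSecurePRNG (I : Set ℕ) (ℓ : ℕ → ℕ) (G : List Bool → List Bool) : Prop :=
  IsPRNG I ℓ G ∧ IsSecure I ℓ G

/-- Bitwise exclusive or of two strings (of the same length). -/
def xorStr (u v : List Bool) : List Bool := List.zipWith xor u v

/-- The `i`-th block (counted from `0`) of length `N` of the string `w`. -/
def block (N : ℕ) (w : List Bool) (i : ℕ) : List Bool := (w.drop (i * N)).take N

/-- The xor-based generator built on `H`. It maps `x₀ S₀`, with `x₀` and `S₀` of length `N`, to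
`(x₀ ⊕ S₀ ⊕ S₁)(x₀ ⊕ S₀ ⊕ S₁ ⊕ S₂) … (x₀ ⊕ S₀ ⊕ S₁ ⊕ ⋯ ⊕ S_k)`, where `H(S₀) = S₁ … S_k` and
every `S_i` has length `N`. -/
def xorGenerator (k : ℕ) (H : List Bool → List Bool) (s : List Bool) : List Bool :=
  let N := s.length / 2
  let x₀ := s.take N
  let S₀ := s.drop N
  (List.range k).flatMap fun j =>
    (List.range (j + 1)).foldl (fun acc i => xorStr acc (block N (H S₀) i)) (xorStr x₀ S₀)

end XorPRNG

end

namespace XorPRNG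

/-! ### Distributions -/

section Distributions

/-! Put y = x₀ ⊕ S₀. For each fixed S₀, y is uniform because x₀ is, and X(x₀S₀) is the sequence of
partial sums y ⊕ S₁, y ⊕ S₁ ⊕ S₂, … of the blocks of H(S₀). For each fixed y, forming partial sums
is a length-preserving injection. Given a distinguisher D for X, let D' draw y itself, form the
partial sums of its input w from y, and run D on them. On H(U_N) it accepts as often as D does on
X(U_2N) (`PPT.acceptProb_reduce_map`); on a uniform input it accepts as often as D
(`PPT.acceptProb_reduce_uniformBits`). The two advantages agree, so security of H at N gives
security of X at 2N.

The longer task is to realise D' as a polynomial-time machine that sees w, of length kN, but not N.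
Each output bit is the input bit xor the output bit N places earlier (a bit of y at the start), so a
shift register holding y suffices (`flatMap_foldl_block`); a queue made of two stacks implements it.
The N bits of y come from tossing one coin per bit of w and keeping every k-th one
(`uniformBits_bind_extract`), which takes only a counter modulo k. `polyTime_comp_prepare` joins
this preparation to the machine of D. -/

theorem map_uniformOfFintype_equiv {α β : Type*} [Fintype α] [Nonempty α] [Fintype β] [Nonempty β]
    (e : α ≃ β) : (PMF.uniformOfFintype α).map e = PMF.uniformOfFintype β := by
  classical
  ext b
  rw [PMF.map_apply, tsum_eq_single (e.symm b)]
  · simp [Fintype.card_congr e]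
  · rintro a ha
    rw [if_neg]
    rintro rfl
    simp at ha

theorem uniformOfFintype_prod {α β : Type*} [Fintype α] [Nonempty α] [Fintype β] [Nonempty β] :
    PMF.uniformOfFintype (α × β) =
      (PMF.uniformOfFintype α).bind fun a => (PMF.uniformOfFintype β).map (Prod.mk a) := by
  classical
  ext ⟨a, b⟩
  rw [PMF.bind_apply, tsum_eq_single a]
  · rw [PMF.map_apply, tsum_eq_single b]
    · simp only [PMF.uniformOfFintype_apply, Fintype.card_prod, if_true]
      push_cast
      rw [ENNReal.mul_inv] <;> simp
    · intro b' hb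
      rw [if_neg]
      simpa using fun h => hb h.symm
  · intro a' ha
    rw [PMF.map_apply]
    simp [ha.symm]

/-- A uniform string of length `m + n` is the concatenation of independent uniform strings. -/
theorem uniformBits_add_bind {γ : Type*} (m n : ℕ) (f : List Bool → PMF γ) :
    (uniformBits (m + n)).bind f =
      (uniformBits m).bind fun u => (uniformBits n).bind fun v => f (u ++ v) := by
  unfold uniformBits
  rw [← map_uniformOfFintype_equiv (Fin.appendEquiv m n), uniformOfFintype_prod]
  simp only [PMF.map_bind, PMF.bind_bind, PMF.bind_map, PMF.map_comp, Function.comp_def,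
    Fin.appendEquiv, Equiv.coe_fn_mk, List.ofFn_fin_append]

theorem bind_congr_of_mem_support {α β : Type*} {μ : PMF α} {f g : α → PMF β}
    (h : ∀ a ∈ μ.support, f a = g a) : μ.bind f = μ.bind g := by
  ext b
  rw [PMF.bind_apply, PMF.bind_apply]
  refine tsum_congr fun a => ?_
  by_cases ha : a ∈ μ.support
  · rw [h a ha]
  · rw [PMF.apply_eq_zero_iff _ _ |>.2 ha, zero_mul, zero_mul]

theorem length_of_mem_support {n : ℕ} {w : List Bool} (h : w ∈ (uniformBits n).support) :
    w.length = n := by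
  rw [uniformBits, PMF.support_map] at h
  obtain ⟨v, -, rfl⟩ := h
  simp

/-- The distributions live on strings of all lengths, whereas the identities used below hold only at
the right length. -/
theorem uniformBits_bind_congr {γ : Type*} {n : ℕ} {f g : List Bool → PMF γ}
    (h : ∀ w : List Bool, w.length = n → f w = g w) :
    (uniformBits n).bind f = (uniformBits n).bind g :=
  bind_congr_of_mem_support fun w hw => h w (length_of_mem_support hw)

/-- An injective length-preserving map preserves the uniform distribution. -/
theorem uniformBits_map_of_injOn {n : ℕ} {f : List Bool → List Bool}
    (hlen : ∀ w : List Bool, w.length = n → (f w).length = n)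
    (hinj : Set.InjOn f {w | w.length = n}) : (uniformBits n).map f = uniformBits n := by
  -- Transport `f` to a finite type, where injectivity gives bijectivity.
  let g : (Fin n → Bool) → Fin n → Bool := fun v i =>
    (f (List.ofFn v)).get (i.cast (hlen _ (by simp)).symm)
  have hg : ∀ v, List.ofFn (g v) = f (List.ofFn v) := by
    intro v
    apply List.ext_get
    · simp [hlen (List.ofFn v) (by simp)]
    · intro i h₁ h₂
      simp [g]
  have hginj : Function.Injective g := by
    intro u v huv
    have : f (List.ofFn u) = f (List.ofFn v) := by rw [← hg, ← hg, huv]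
    exact List.ofFn_injective (hinj (by simp) (by simp) this)
  have hbij : Function.Bijective g := Finite.injective_iff_bijective.1 hginj
  conv_rhs => rw [uniformBits, ← map_uniformOfFintype_equiv (Equiv.ofBijective g hbij)]
  rw [uniformBits, PMF.map_comp, PMF.map_comp]
  congr 1
  funext v
  exact (hg v).symm

theorem uniformBits_zero : uniformBits 0 = PMF.pure [] := by
  have : (List.ofFn : (Fin 0 → Bool) → List Bool) = Function.const _ [] := by
    funext v; simp
  rw [uniformBits, this, PMF.map_const]

end Distributions

/-! ### The feedback recursion -/

section Feedback

/-- The output of a shift register that starts with the contents `q` and whose feedback is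
exclusive-ored with the successive bits of the second argument. -/
def feedback : List Bool → List Bool → List Bool
  | _, [] => []
  | [], _ :: _ => []
  | a :: q, b :: w => xor a b :: feedback (q ++ [xor a b]) w

@[simp] theorem feedback_nil (q : List Bool) : feedback q [] = [] := by
  cases q <;> rfl

theorem length_feedback : ∀ (q w : List Bool), q ≠ [] → (feedback q w).length = w.length
  | _, [], _ => by simp
  | [], _ :: _, h => absurd rfl h
  | a :: q, b :: w, _ => by simp [feedback, length_feedback (q ++ [xor a b]) w (by simp)]

/-- The head of the register is known, so the first output bit determines the first input bit, and
the two registers stay equal. -/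
theorem feedback_injective : ∀ (q u v : List Bool), q ≠ [] → feedback q u = feedback q v → u = v
  | _, [], [], _, _ => rfl
  | [], _, _, h, _ => absurd rfl h
  | a :: q, [], c :: v, _, h => by simp [feedback] at h
  | a :: q, b :: u, [], _, h => by simp [feedback] at h
  | a :: q, b :: u, c :: v, _, h => by
    simp only [feedback, List.cons.injEq] at h
    obtain ⟨h₁, h₂⟩ := h
    have hbc : b = c := by simpa using h₁
    subst hbc
    rw [feedback_injective _ u v (by simp) h₂]

/-- New bits queue up behind `z`, so they are not read back while `y` is consumed. With `z = []`
this is one block of the partial sums. -/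
theorem feedback_append : ∀ (y z u w : List Bool), u.length = y.length →
    feedback (y ++ z) (u ++ w) = xorStr y u ++ feedback (z ++ xorStr y u) w
  | [], z, [], w, _ => by simp [xorStr]
  | a :: y, z, b :: u, w, h => by
    have := feedback_append y (z ++ [xor a b]) u w (by simpa using h)
    simp only [List.append_assoc] at this
    simp [feedback, this, xorStr]

theorem length_xorStr {u v : List Bool} (h : u.length = v.length) :
    (xorStr u v).length = v.length := by
  simp [xorStr, h]

theorem xorStr_cancel : ∀ {u v : List Bool}, u.length = v.length → xorStr (xorStr u v) v = u
  | [], [], _ => rfl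
  | a :: u, b :: v, h => by
    have := xorStr_cancel (u := u) (v := v) (by simpa using h)
    simp only [xorStr] at this
    simp [xorStr, this]

theorem block_zero (N : ℕ) (w : List Bool) : block N w 0 = w.take N := by
  simp [block]

theorem block_succ (N : ℕ) (w : List Bool) (i : ℕ) : block N w (i + 1) = block N (w.drop N) i := by
  simp [block, List.drop_drop, Nat.succ_mul, Nat.add_comm]

/-- The partial sums of the blocks of `w` are produced by a shift register. -/
theorem flatMap_foldl_block (N : ℕ) : ∀ (k : ℕ) (y w : List Bool), y.length = N →
    w.length = k * N →
    ((List.range k).flatMap fun j =>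
      (List.range (j + 1)).foldl (fun acc i => xorStr acc (block N w i)) y) = feedback y w
  | 0, y, w, _, hw => by
    have : w = [] := List.length_eq_zero_iff.1 (by simpa using hw)
    simp [this]
  | k + 1, y, w, hy, hw => by
    have hN : N ≤ w.length := by rw [hw]; nlinarith
    have htake : (w.take N).length = y.length := by simp [hy, hN]
    have ih := flatMap_foldl_block N k (xorStr y (w.take N)) (w.drop N)
      (by rw [length_xorStr htake.symm, htake, hy])
      (by rw [List.length_drop, hw, Nat.succ_mul, Nat.add_sub_cancel])
    have hf := feedback_append y [] (w.take N) (w.drop N) htake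
    rw [List.append_nil, List.take_append_drop, List.nil_append] at hf
    -- The term `j = 0` is the first block; in every later term the first fold step replaces `y` by
    -- the starting value of `ih`.
    rw [hf, ← ih, List.range_succ_eq_map, List.flatMap_cons, List.flatMap_map]
    congr 1
    · simp [block_zero]
    · congr 1
      funext j
      rw [List.range_succ_eq_map, List.foldl_cons, List.foldl_map, block_zero]
      simp only [Nat.succ_eq_add_one, block_succ]

theorem xorGenerator_append {k N : ℕ} {H : List Bool → List Bool} {x S : List Bool}
    (hx : x.length = N) (hS : S.length = N) (hH : (H S).length = k * N) :
    xorGenerator k H (x ++ S) = feedback (xorStr x S) (H S) := by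
  have hlen : (x ++ S).length / 2 = N := by rw [List.length_append]; omega
  rw [← flatMap_foldl_block N k (xorStr x S) (H S) (by rw [length_xorStr (by omega), hS]) hH]
  unfold xorGenerator
  simp only [hlen]
  rw [← hx, List.take_left, List.drop_left, hx]

end Feedback

/-! ### Computability of the generator -/

section Computability

theorem primrec₂_xorStr : Primrec₂ xorStr := by
  -- The default `false` is never used, as every index lies below both lengths.
  have h : Primrec₂ fun u v : List Bool => (List.range (min u.length v.length)).map fun i =>
      xor (u.getD i false) (v.getD i false) := by
    refine Primrec.list_map (Primrec.list_range.comp (Primrec.nat_min.comp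
      (Primrec.list_length.comp .fst) (Primrec.list_length.comp .snd))) ?_
    exact (Primrec.dom_finite (fun p : Bool × Bool => xor p.1 p.2)).comp
      (((Primrec.list_getD false).comp (Primrec.fst.comp .fst) .snd).pair
        ((Primrec.list_getD false).comp (Primrec.snd.comp .fst) .snd))
  refine h.of_eq fun u v => ?_
  apply List.ext_getElem
  · simp [xorStr]
  · intro i h₁ h₂
    simp only [xorStr, List.length_zipWith] at h₂
    have := Nat.lt_of_lt_of_le h₂ (min_le_left _ _)
    have := Nat.lt_of_lt_of_le h₂ (min_le_right _ _)
    simp [xorStr, *]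

theorem primrec_block : Primrec fun p : ℕ × List Bool × ℕ => block p.1 p.2.1 p.2.2 :=
  Primrec.list_take.comp Primrec.fst (Primrec.list_drop.comp
    (Primrec.nat_mul.comp (Primrec.snd.comp Primrec.snd) Primrec.fst)
    (Primrec.fst.comp Primrec.snd))

theorem computable_xorGenerator (k : ℕ) {H : List Bool → List Bool} (hH : Computable H) :
    Computable (xorGenerator k H) := by
  have hhalf : Primrec fun s : List Bool => s.length / 2 :=
    Primrec.nat_div.comp Primrec.list_length (.const 2)
  have hinit : Primrec fun s : List Bool => xorStr (s.take (s.length / 2)) (s.drop (s.length / 2)) :=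
    primrec₂_xorStr.comp (Primrec.list_take.comp hhalf .id) (Primrec.list_drop.comp hhalf .id)
  -- `p.2` stands for the value of `H`, which is only computable; all the rest is primitive
  -- recursive.
  have hF : Primrec fun p : List Bool × List Bool => (List.range k).flatMap fun j =>
      (List.range (j + 1)).foldl (fun acc i => xorStr acc (block (p.1.length / 2) p.2 i))
        (xorStr (p.1.take (p.1.length / 2)) (p.1.drop (p.1.length / 2))) := by
    refine Primrec.list_flatMap (.const _) ?_
    have hj : Primrec fun q : (List Bool × List Bool) × ℕ => List.range (q.2 + 1) :=
      Primrec.list_range.comp (Primrec.succ.comp Primrec.snd)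
    have hs : Primrec fun q : (List Bool × List Bool) × ℕ => q.1.1 := Primrec.fst.comp .fst
    have hp : Primrec fun x : ((List Bool × List Bool) × ℕ) × List Bool × ℕ => x.1.1 :=
      Primrec.fst.comp .fst
    have hx : Primrec₂ fun (q : (List Bool × List Bool) × ℕ) (x : List Bool × ℕ) =>
        xorStr x.1 (block (q.1.1.length / 2) q.1.2 x.2) :=
      primrec₂_xorStr.comp (Primrec.fst.comp .snd) (primrec_block.comp
        ((hhalf.comp (Primrec.fst.comp hp)).pair
          ((Primrec.snd.comp hp).pair (Primrec.snd.comp .snd))))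
    exact Primrec.list_foldl hj (hinit.comp hs) hx
  exact hF.to_comp.comp (Computable.id.pair
    (hH.comp (Primrec.list_drop.comp hhalf .id).to_comp))

end Computability

/-! ### Reachability within a number of steps -/

section ReachesIn

/-- `f` leads from `a` to `b` in at most `n` steps. -/
def ReachesIn {σ : Type*} (f : σ → Option σ) (n : ℕ) (a b : σ) : Prop :=
  Nonempty (StateTransition.EvalsToInTime f a (some b) n)

variable {σ τ : Type*} {f : σ → Option σ} {a b c : σ} {m n : ℕ}

theorem ReachesIn.mono (h : ReachesIn f m a b) (hmn : m ≤ n) : ReachesIn f n a b :=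
  h.elim fun h => ⟨⟨h.toEvalsTo, h.steps_le_m.trans hmn⟩⟩

theorem ReachesIn.trans (h₁ : ReachesIn f m a b) (h₂ : ReachesIn f n b c) :
    ReachesIn f (m + n) a c :=
  h₁.elim fun h₁ => h₂.elim fun h₂ =>
    ⟨Nat.add_comm n m ▸ StateTransition.EvalsToInTime.trans f m n a b (some c) h₁ h₂⟩

theorem ReachesIn.single (h : f a = some b) : ReachesIn f 1 a b :=
  ⟨⟨⟨1, h⟩, le_rfl⟩⟩

theorem ReachesIn.head (h₁ : f a = some b) (h₂ : ReachesIn f n b c) : ReachesIn f (n + 1) a c :=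
  ((ReachesIn.single h₁).trans h₂).mono (by omega)

/-- A map that commutes with the step functions preserves reachability. -/
theorem ReachesIn.map {g : τ → Option τ} (φ : σ → τ) (hφ : ∀ x, g (φ x) = (f x).map φ)
    (h : ReachesIn f n a b) : ReachesIn g n (φ a) (φ b) := by
  obtain ⟨⟨⟨s, hs⟩, hsn⟩⟩ := h
  have key : ∀ (s : ℕ) (x : Option σ),
      (flip Bind.bind g)^[s] (x.map φ) = ((flip Bind.bind f)^[s] x).map φ := by
    intro s
    induction s with
    | zero => intro x; rfl
    | succ s ih =>
      intro x
      rw [Function.iterate_succ_apply, Function.iterate_succ_apply, ← ih]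
      congr 1
      cases x with
      | none => rfl
      | some x => exact hφ x
  exact ⟨⟨⟨s, (key s (some a)).trans (by rw [hs]; rfl)⟩, hsn⟩⟩

end ReachesIn

/-! ### Extraction of coin tosses -/

section Extract

/-- Reads `n` coin tosses off a string (absent ones count as `false`), keeps those at which the
counter, running down from `k` to `0` again and again, vanishes, and returns them together with the
rest of the string. -/
def extract (k : ℕ) : ℕ → ℕ → List Bool → List Bool × List Bool
  | 0, _, r => ([], r)
  | n + 1, 0, r => (r.headD false :: (extract k n k r.tail).1, (extract k n k r.tail).2)
  | n + 1, c + 1, r => extract k n c r.tail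

theorem length_extract_fst_le (k : ℕ) :
    ∀ (n c : ℕ) (r : List Bool), (extract k n c r).1.length ≤ n
  | 0, _, _ => by simp [extract]
  | n + 1, 0, r => by simpa [extract] using length_extract_fst_le k n k r.tail
  | n + 1, c + 1, r => (length_extract_fst_le k n c r.tail).trans (Nat.le_succ n)

theorem length_extract_snd_le (k : ℕ) :
    ∀ (n c : ℕ) (r : List Bool), (extract k n c r).2.length ≤ r.length
  | 0, _, _ => le_rfl
  | n + 1, 0, r => (length_extract_snd_le k n k r.tail).trans (by simp)
  | n + 1, c + 1, r => (length_extract_snd_le k n c r.tail).trans (by simp)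

theorem extract_add (k n : ℕ) :
    ∀ (c : ℕ) (r : List Bool), extract k (n + c) c r = extract k n 0 (r.drop c)
  | 0, _ => rfl
  | c + 1, r => by
    rw [← Nat.add_assoc, extract, extract_add k n c, List.drop_tail]

/-- One period of the counter: a toss is kept, then `k` are skipped. -/
theorem extract_block {k N : ℕ} {b : Bool} {u r : List Bool} (hu : u.length = k) :
    extract k ((k + 1) * (N + 1)) 0 (b :: (u ++ r)) =
      (b :: (extract k ((k + 1) * N) 0 r).1, (extract k ((k + 1) * N) 0 r).2) := by
  rw [Nat.mul_succ, ← Nat.add_assoc, extract, List.tail_cons, extract_add, ← hu, List.drop_left]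
  rfl

/-- From uniform coin tosses `extract` makes two independent uniform strings. -/
theorem uniformBits_bind_extract {γ : Type*} (k c : ℕ) :
    ∀ (N : ℕ) (f : List Bool → List Bool → PMF γ),
      ((uniformBits ((k + 1) * N + c)).bind fun r =>
        f (extract k ((k + 1) * N) 0 r).1 (extract k ((k + 1) * N) 0 r).2) =
      (uniformBits N).bind fun y => (uniformBits c).bind fun r => f y r
  | 0, f => by simp [uniformBits_zero, extract]
  | N + 1, f => by
    have h₁ : (k + 1) * (N + 1) + c = 1 + (k + ((k + 1) * N + c)) := by ring
    rw [h₁, Nat.add_comm N 1, uniformBits_add_bind, uniformBits_add_bind, Nat.add_comm 1 N]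
    refine uniformBits_bind_congr fun a ha => ?_
    obtain ⟨b, rfl⟩ := List.length_eq_one_iff.1 ha
    rw [uniformBits_add_bind, ← uniformBits_bind_extract k c N fun y r => f ([b] ++ y) r]
    -- Reinsert the `k` skipped tosses on the right, as a draw that nothing depends on.
    rw [← PMF.bind_const (uniformBits k) ((uniformBits ((k + 1) * N + c)).bind _)]
    refine uniformBits_bind_congr fun u hu => ?_
    congr 1
    funext r
    rw [List.singleton_append, extract_block hu]
    rfl

end Extract

/-! ### The machine -/

section Machine

/-- The stacks added to a given machine. -/
inductive WorkStack
  | buffer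
  | word
  | front
  | back
  deriving DecidableEq

instance : Fintype WorkStack where
  elems := {.buffer, .word, .front, .back}
  complete i := by cases i <;> simp

/-- The labels added to a given machine. -/
inductive Phase
  | readWord
  | sample
  | mix
  | refill
  | clearFront
  | clearBack
  | unload
  deriving DecidableEq

instance : Fintype Phase where
  elems := {.readWord, .sample, .mix, .refill, .clearFront, .clearBack, .unload}
  complete p := by cases p <;> simp

/-- The registers added to a given machine: a symbol, a bit and a counter. -/
structure Registers (k : ℕ) where
  symbol : Option (Bool ⊕ Bool)
  bit : Option Bool
  counter : Fin (k + 1)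
  deriving Fintype

/-- The cleared registers with a given value of the counter. -/
def Registers.reset {k : ℕ} (c : Fin (k + 1)) : Registers k := ⟨none, none, c⟩

/-- The bit held in the symbol register, `false` if there is none. -/
def Registers.symbolBit {k : ℕ} (v : Registers k) : Bool :=
  v.symbol.elim false (Sum.elim id id)

/-- The bit held in the bit register, `false` if there is none. -/
def Registers.theBit {k : ℕ} (v : Registers k) : Bool := v.bit.getD false

/-- The counter runs down to zero and then starts again at its greatest value. -/
def countDown {k : ℕ} (c : Fin (k + 1)) : Fin (k + 1) :=
  if c.val = 0 then Fin.last k else ⟨c.val - 1, by omega⟩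

variable (tm : FinTM2) (k : ℕ)

/-- The alphabets of the extended machine. -/
abbrev ExtΓ : tm.K ⊕ WorkStack → Type
  | .inl i => tm.Γ i
  | .inr _ => Bool

/-- The statements of the extended machine. -/
abbrev ExtStmt : Type := TM2.Stmt (ExtΓ tm) (tm.Λ ⊕ Phase) (tm.σ × Registers k)

/-- The configurations of the extended machine. -/
abbrev ExtCfg : Type := TM2.Cfg (ExtΓ tm) (tm.Λ ⊕ Phase) (tm.σ × Registers k)

variable {tm}

/-- A statement of the given machine, as a statement of the extended machine. -/
def liftStmt : TM2.Stmt tm.Γ tm.Λ tm.σ → ExtStmt tm k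
  | .push i f q => .push (.inl i) (fun v => f v.1) (liftStmt q)
  | .peek i f q => .peek (.inl i) (fun v x => (f v.1 x, v.2)) (liftStmt q)
  | .pop i f q => .pop (.inl i) (fun v x => (f v.1 x, v.2)) (liftStmt q)
  | .load f q => .load (fun v => (f v.1, v.2)) (liftStmt q)
  | .branch f q₁ q₂ => .branch (fun v => f v.1) (liftStmt q₁) (liftStmt q₂)
  | .goto f => .goto fun v => .inl (f v.1)
  | .halt => .halt

/-- The contents of the stacks of the extended machine. -/
def joinStk (S : ∀ i, List (tm.Γ i)) (T : WorkStack → List Bool) : ∀ i, List (ExtΓ tm i)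
  | .inl i => S i
  | .inr i => T i

/-- A configuration of the given machine, as a configuration of the extended machine. -/
def liftCfg (c : TM2.Cfg tm.Γ tm.Λ tm.σ) : ExtCfg tm k :=
  ⟨c.l.map .inl, (c.var, .reset 0), joinStk c.stk fun _ => []⟩

theorem update_joinStk_inl (S : ∀ i, List (tm.Γ i)) (T : WorkStack → List Bool) (i : tm.K)
    (x : List (tm.Γ i)) :
    Function.update (joinStk S T) (.inl i) x = joinStk (Function.update S i x) T := by
  funext j
  rcases j with j | j
  · by_cases h : j = i
    · subst h; simp [joinStk]
    · have : (Sum.inl j : tm.K ⊕ WorkStack) ≠ .inl i := fun h' => h (Sum.inl_injective h')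
      rw [Function.update_of_ne this]
      simp [joinStk, h]
  · rw [Function.update_of_ne (by simp)]
    rfl

theorem update_joinStk_inr (S : ∀ i, List (tm.Γ i)) (T : WorkStack → List Bool) (i : WorkStack)
    (x : List Bool) :
    Function.update (joinStk S T) (.inr i) x = joinStk S (Function.update T i x) := by
  funext j
  rcases j with j | j
  · rw [Function.update_of_ne (by simp)]
    rfl
  · by_cases h : j = i
    · subst h; simp [joinStk]
    · have : (Sum.inr j : tm.K ⊕ WorkStack) ≠ .inr i := fun h' => h (Sum.inr_injective h')
      rw [Function.update_of_ne this]
      simp [joinStk, h]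

/-- Lifted statements never touch the added stacks and registers, so these remain empty and reset up
to halting. -/
theorem stepAux_liftStmt (q : TM2.Stmt tm.Γ tm.Λ tm.σ) (v : tm.σ) (S : ∀ i, List (tm.Γ i)) :
    TM2.stepAux (liftStmt k q) (v, .reset 0) (joinStk S fun _ => []) =
      liftCfg k (TM2.stepAux q v S) := by
  induction q generalizing v S with
  | push i f q ih =>
    simp only [liftStmt, TM2.stepAux, update_joinStk_inl]
    exact ih _ _
  | peek i f q ih =>
    simp only [liftStmt, TM2.stepAux]
    exact ih _ _
  | pop i f q ih =>
    simp only [liftStmt, TM2.stepAux, update_joinStk_inl]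
    exact ih _ _
  | load f q ih =>
    simp only [liftStmt, TM2.stepAux]
    exact ih _ _
  | branch f q₁ q₂ ih₁ ih₂ =>
    simp only [liftStmt, TM2.stepAux]
    cases f v
    · exact ih₂ _ _
    · exact ih₁ _ _
  | goto f => rfl
  | halt => rfl

variable (e : tm.Γ tm.k₀ ≃ Bool ⊕ Bool)

open WorkStack Phase TM2.Stmt in
/-- The program that prepares the input of the given machine. -/
def program : Phase → ExtStmt tm k
  | readWord =>
    -- Peeking leaves the first coin toss in place for the next phase.
    peek (.inl tm.k₀) (fun v x => (v.1, { v.2 with symbol := x.map e })) <|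
    branch (fun v => v.2.symbol.any Sum.isLeft)
      (pop (.inl tm.k₀) (fun v _ => v) <|
        push (.inr buffer) (fun v => v.2.symbolBit) <|
        load (fun v => (v.1, .reset v.2.counter)) <|
        goto fun _ => .inr readWord)
      (load (fun v => (v.1, .reset v.2.counter)) <|
        goto fun _ => .inr sample)
  | sample =>
    -- Emptying the buffer meters one toss per bit of the word and restores the order of the word.
    pop (.inr buffer) (fun v x => (v.1, { v.2 with bit := x })) <|
    branch (fun v => v.2.bit.isSome)
      (push (.inr word) (fun v => v.2.theBit) <|
        pop (.inl tm.k₀) (fun v x => (v.1, { v.2 with symbol := x.map e })) <|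
        branch (fun v => v.2.counter.val = 0)
          (push (.inr front) (fun v => v.2.symbolBit) <|
            load (fun v => (v.1, .reset (countDown v.2.counter))) <|
            goto fun _ => .inr sample)
          (load (fun v => (v.1, .reset (countDown v.2.counter))) <|
            goto fun _ => .inr sample))
      (load (fun v => (v.1, .reset 0)) <|
        goto fun _ => .inr mix)
  | mix =>
    pop (.inr word) (fun v x => (v.1, { v.2 with bit := x })) <|
    branch (fun v => v.2.bit.isSome)
      (pop (.inr front) (fun v x => (v.1, { v.2 with symbol := Option.map Sum.inl x })) <|
        branch (fun v => v.2.symbol.isSome)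
          (push (.inr back) (fun v => xor v.2.symbolBit v.2.theBit) <|
            push (.inr buffer) (fun v => xor v.2.symbolBit v.2.theBit) <|
            load (fun v => (v.1, .reset 0)) <|
            goto fun _ => .inr mix)
          -- The front of the queue is empty: return the bit to `word` and reverse the back of the
          -- queue onto the front.
          (push (.inr word) (fun v => v.2.theBit) <|
            load (fun v => (v.1, .reset 0)) <|
            goto fun _ => .inr refill))
      (load (fun v => (v.1, .reset 0)) <|
        goto fun _ => .inr clearFront)
  | refill =>
    pop (.inr back) (fun v x => (v.1, { v.2 with bit := x })) <|
    branch (fun v => v.2.bit.isSome)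
      (push (.inr front) (fun v => v.2.theBit) <|
        load (fun v => (v.1, .reset 0)) <|
        goto fun _ => .inr refill)
      (load (fun v => (v.1, .reset 0)) <|
        goto fun _ => .inr mix)
  | clearFront =>
    -- The register is still full; `liftCfg` demands empty work stacks.
    pop (.inr front) (fun v x => (v.1, { v.2 with bit := x })) <|
    branch (fun v => v.2.bit.isSome)
      (load (fun v => (v.1, .reset 0)) <|
        goto fun _ => .inr clearFront)
      (load (fun v => (v.1, .reset 0)) <|
        goto fun _ => .inr clearBack)
  | clearBack =>
    pop (.inr back) (fun v x => (v.1, { v.2 with bit := x })) <|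
    branch (fun v => v.2.bit.isSome)
      (load (fun v => (v.1, .reset 0)) <|
        goto fun _ => .inr clearBack)
      (load (fun v => (v.1, .reset 0)) <|
        goto fun _ => .inr unload)
  | unload =>
    pop (.inr buffer) (fun v x => (v.1, { v.2 with bit := x })) <|
    branch (fun v => v.2.bit.isSome)
      (push (.inl tm.k₀) (fun v => e.symm (.inl v.2.theBit)) <|
        load (fun v => (v.1, .reset 0)) <|
        goto fun _ => .inr unload)
      (load (fun v => (v.1, .reset 0)) <|
        goto fun _ => .inl tm.main)

/-- The machine that prepares the input of `tm` and then runs `tm`. -/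
def extend : FinTM2 where
  K := tm.K ⊕ WorkStack
  kFin := letI := tm.kFin; inferInstance
  k₀ := .inl tm.k₀
  k₁ := .inl tm.k₁
  Γ := ExtΓ tm
  Λ := tm.Λ ⊕ Phase
  main := .inr .readWord
  ΛFin := letI := tm.ΛFin; inferInstance
  σ := tm.σ × Registers k
  initialState := (tm.initialState, .reset 0)
  σFin := letI := tm.σFin; inferInstance
  Γk₀Fin := tm.Γk₀Fin
  m := Sum.elim (fun l => liftStmt k (tm.m l)) (program k e)

/-- The step function of the extended machine. -/
abbrev extStep : ExtCfg tm k → Option (ExtCfg tm k) :=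
  TM2.step (Sum.elim (fun l => liftStmt k (tm.m l)) (program k e))

theorem step_liftCfg (c : TM2.Cfg tm.Γ tm.Λ tm.σ) :
    extStep k e (liftCfg k c) = (TM2.step tm.m c).map (liftCfg k) := by
  rcases c with ⟨_ | l, v, S⟩
  · rfl
  · exact congrArg some (stepAux_liftStmt k (tm.m l) v S)

/-- The contents of the work stacks. -/
def workStk (buffer word front back : List Bool) : WorkStack → List Bool
  | .buffer => buffer
  | .word => word
  | .front => front
  | .back => back

/-- The stacks of the given machine when all of them but the input stack are empty. -/
def inputStk (I : List (Bool ⊕ Bool)) : ∀ i, List (tm.Γ i) :=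
  Function.update (fun _ => []) tm.k₀ (I.map e.symm)

/-- The configurations of the extended machine while it prepares the input. -/
def prepCfg (p : Phase) (c : Fin (k + 1)) (I : List (Bool ⊕ Bool))
    (buffer word front back : List Bool) : ExtCfg tm k :=
  ⟨some (.inr p), (tm.initialState, .reset c),
    joinStk (inputStk e I) (workStk buffer word front back)⟩

section Stacks

variable (I J : List (Bool ⊕ Bool)) (u w f b x : List Bool)

@[simp] theorem inputStk_k₀ : inputStk e I tm.k₀ = I.map e.symm := by simp [inputStk]

@[simp] theorem update_inputStk :
    Function.update (inputStk e I) tm.k₀ (J.map e.symm) = inputStk e J := by simp [inputStk]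

@[simp] theorem update_workStk_buffer :
    Function.update (workStk u w f b) .buffer x = workStk x w f b := by
  funext i; cases i <;> rfl

@[simp] theorem update_workStk_word :
    Function.update (workStk u w f b) .word x = workStk u x f b := by
  funext i; cases i <;> rfl

@[simp] theorem update_workStk_front :
    Function.update (workStk u w f b) .front x = workStk u w x b := by
  funext i; cases i <;> rfl

@[simp] theorem update_workStk_back :
    Function.update (workStk u w f b) .back x = workStk u w f x := by
  funext i; cases i <;> rfl

end Stacks

/-! ### Single steps of the preparing program -/

section Steps

variable (I : List (Bool ⊕ Bool)) (a b : Bool) (u w f g r : List Bool) (c : Fin (k + 1))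

theorem step_readWord_inl :
    extStep k e (prepCfg k e .readWord c (.inl b :: I) u w f g) =
      some (prepCfg k e .readWord c I (b :: u) w f g) := by
  simp [prepCfg, program, update_joinStk_inl, update_joinStk_inr, joinStk, workStk,
    Registers.symbolBit, Registers.reset]

theorem step_readWord_inr :
    extStep k e (prepCfg k e .readWord c (r.map .inr) u w f g) =
      some (prepCfg k e .sample c (r.map .inr) u w f g) := by
  cases r <;> simp [prepCfg, program, joinStk, Registers.reset]

theorem step_sample_cons :
    extStep k e (prepCfg k e .sample c (r.map .inr) (b :: u) w f g) =
      some (prepCfg k e .sample (countDown c) (r.tail.map .inr) u (b :: w)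
        (if c.val = 0 then r.headD false :: f else f) g) := by
  have h₀ : Function.update (inputStk e []) tm.k₀ [] = inputStk e [] := update_inputStk e [] []
  have h₁ (J : List (Bool ⊕ Bool)) (t : List Bool) :
      Function.update (inputStk e J) tm.k₀ (t.map (e.symm ∘ .inr)) = inputStk e (t.map .inr) := by
    rw [← List.map_map, update_inputStk]
  by_cases hc : c = 0 <;> cases r <;>
  simp [prepCfg, program, update_joinStk_inl, update_joinStk_inr, joinStk, workStk,
    Registers.symbolBit, Registers.theBit, Registers.reset, hc, h₀, h₁]

theorem step_sample_nil :
    extStep k e (prepCfg k e .sample c I [] w f g) = some (prepCfg k e .mix 0 I [] w f g) := by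
  simp [prepCfg, program, update_joinStk_inr, joinStk, workStk, Registers.reset]

theorem step_mix_cons :
    extStep k e (prepCfg k e .mix 0 I u (b :: w) (a :: f) g) =
      some (prepCfg k e .mix 0 I (xor a b :: u) w f (xor a b :: g)) := by
  simp [prepCfg, program, update_joinStk_inr, joinStk, workStk,
    Registers.symbolBit, Registers.theBit, Registers.reset]

theorem step_mix_empty :
    extStep k e (prepCfg k e .mix 0 I u (b :: w) [] g) =
      some (prepCfg k e .refill 0 I u (b :: w) [] g) := by
  simp [prepCfg, program, update_joinStk_inr, joinStk, workStk,
    Registers.theBit, Registers.reset]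

theorem step_mix_nil :
    extStep k e (prepCfg k e .mix 0 I u [] f g) =
      some (prepCfg k e .clearFront 0 I u [] f g) := by
  simp [prepCfg, program, update_joinStk_inr, joinStk, workStk, Registers.reset]

theorem step_refill_cons :
    extStep k e (prepCfg k e .refill 0 I u w f (b :: g)) =
      some (prepCfg k e .refill 0 I u w (b :: f) g) := by
  simp [prepCfg, program, update_joinStk_inr, joinStk, workStk, Registers.theBit, Registers.reset]

theorem step_refill_nil :
    extStep k e (prepCfg k e .refill 0 I u w f []) = some (prepCfg k e .mix 0 I u w f []) := by
  simp [prepCfg, program, update_joinStk_inr, joinStk, workStk, Registers.reset]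

theorem step_clearFront_cons :
    extStep k e (prepCfg k e .clearFront 0 I u w (b :: f) g) =
      some (prepCfg k e .clearFront 0 I u w f g) := by
  simp [prepCfg, program, update_joinStk_inr, joinStk, workStk, Registers.reset]

theorem step_clearFront_nil :
    extStep k e (prepCfg k e .clearFront 0 I u w [] g) =
      some (prepCfg k e .clearBack 0 I u w [] g) := by
  simp [prepCfg, program, update_joinStk_inr, joinStk, workStk, Registers.reset]

theorem step_clearBack_cons :
    extStep k e (prepCfg k e .clearBack 0 I u w f (b :: g)) =
      some (prepCfg k e .clearBack 0 I u w f g) := by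
  simp [prepCfg, program, update_joinStk_inr, joinStk, workStk, Registers.reset]

theorem step_clearBack_nil :
    extStep k e (prepCfg k e .clearBack 0 I u w f []) =
      some (prepCfg k e .unload 0 I u w f []) := by
  simp [prepCfg, program, update_joinStk_inr, joinStk, workStk, Registers.reset]

theorem step_unload_cons :
    extStep k e (prepCfg k e .unload 0 I (b :: u) w f g) =
      some (prepCfg k e .unload 0 (.inl b :: I) u w f g) := by
  have h : Function.update (inputStk e I) tm.k₀ (e.symm (.inl b) :: I.map e.symm) =
      inputStk e (.inl b :: I) := update_inputStk e I (.inl b :: I)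
  simp [prepCfg, program, update_joinStk_inl, update_joinStk_inr, joinStk, workStk,
    Registers.theBit, Registers.reset, h]

theorem step_unload_nil :
    extStep k e (prepCfg k e .unload 0 I [] [] [] []) =
      some (liftCfg k ⟨some tm.main, tm.initialState, inputStk e I⟩) := by
  have h : workStk [] [] [] [] = fun _ => [] := by funext i; cases i <;> rfl
  simp [prepCfg, program, update_joinStk_inr, joinStk, Registers.reset, liftCfg, h]

end Steps

/-! ### Running times of the phases -/

theorem reachesIn_readWord (r : List Bool) : ∀ (w u : List Bool),
    ReachesIn (extStep k e) (w.length + 1)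
      (prepCfg k e .readWord 0 (w.map .inl ++ r.map .inr) u [] [] [])
      (prepCfg k e .sample 0 (r.map .inr) (w.reverse ++ u) [] [] [])
  | [], u => .single (step_readWord_inr k e u [] [] [] r 0)
  | b :: w, u => by
    have := reachesIn_readWord r w (b :: u)
    simpa using ReachesIn.head (step_readWord_inl k e _ b u [] [] [] 0) this

theorem reachesIn_sample : ∀ (u w f r : List Bool) (c : Fin (k + 1)),
    ReachesIn (extStep k e) (u.length + 1)
      (prepCfg k e .sample c (r.map .inr) u w f [])
      (prepCfg k e .mix 0 ((extract k u.length c r).2.map .inr) [] (u.reverse ++ w)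
        ((extract k u.length c r).1.reverse ++ f) [])
  | [], w, f, r, c => .single (step_sample_nil k e _ w f [] c)
  | b :: u, w, f, r, c => by
    refine .head (step_sample_cons k e b u w f [] r c) ?_
    have h := reachesIn_sample u (b :: w) (if c.val = 0 then r.headD false :: f else f) r.tail
      (countDown c)
    -- Zero and positive counter match the two recursive clauses of `extract`.
    rcases c with ⟨_ | c, hc⟩ <;> simpa [countDown, extract] using h

theorem reachesIn_refill (I : List (Bool ⊕ Bool)) (u w : List Bool) : ∀ (g f : List Bool),
    ReachesIn (extStep k e) (g.length + 1) (prepCfg k e .refill 0 I u w f g)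
      (prepCfg k e .mix 0 I u w (g.reverse ++ f) [])
  | [], f => .single (step_refill_nil k e I u w f)
  | b :: g, f => by
    simpa using ReachesIn.head (step_refill_cons k e I b u w f g)
      (reachesIn_refill I u w g (b :: f))

/-- The mixing phase writes the output of the shift register whose contents are distributed over
two stacks. -/
theorem reachesIn_mix (I : List (Bool ⊕ Bool)) (n : ℕ) : ∀ (w u f g : List Bool),
    f.length + g.length = n → (w = [] ∨ n ≠ 0) → ∃ f' g' : List Bool, f'.length + g'.length = n ∧
      ReachesIn (extStep k e) (w.length * (n + 3) + 1) (prepCfg k e .mix 0 I u w f g)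
        (prepCfg k e .clearFront 0 I ((feedback (f ++ g.reverse) w).reverse ++ u) [] f' g')
  | [], u, f, g, hn, _ => by
    refine ⟨f, g, hn, ?_⟩
    simpa using ReachesIn.single (step_mix_nil k e I u f g)
  | b :: w, u, [], g, hn, h => by
    -- With an empty register, mixing and refilling would alternate forever.
    have hn0 : n ≠ 0 := by simpa using h
    obtain ⟨a, f, hf⟩ : ∃ a f, g.reverse = a :: f := by
      cases hg : g.reverse with
      | nil => simp_all
      | cons a f => exact ⟨a, f, rfl⟩
    have hfn : f.length + 1 = n := by
      rw [← List.length_cons (a := a), ← hf, ← hn]; simp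
    obtain ⟨f', g', hn', hr⟩ := reachesIn_mix I n w (xor a b :: u) f [xor a b] (by simpa using hfn)
      (Or.inr hn0)
    refine ⟨f', g', hn', ?_⟩
    have h₂ := reachesIn_refill k e I u (b :: w) g []
    rw [List.append_nil, hf] at h₂
    have h₃ := (ReachesIn.head (step_mix_empty k e I b u w g) h₂).trans
      (ReachesIn.head (step_mix_cons k e I a b u w f []) hr)
    rw [List.nil_append, hf]
    -- Here `g` has length `n`: a failed mix, a refill of `n + 1` steps and a successful mix make `n
    -- + 3`, the worst cost of one bit.
    refine ReachesIn.mono ?_ (?_ : g.length + 1 + 1 + (w.length * (n + 3) + 1 + 1) ≤ _)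
    · simpa [feedback] using h₃
    · simp only [List.length_cons, List.length_nil] at hn ⊢
      rw [Nat.succ_mul]
      omega
  | b :: w, u, a :: f, g, hn, h => by
    obtain ⟨f', g', hn', hr⟩ := reachesIn_mix I n w (xor a b :: u) f (xor a b :: g)
      (by simp at hn ⊢; omega) (Or.inr (by simpa using h))
    refine ⟨f', g', hn', ?_⟩
    refine ReachesIn.mono ?_ (?_ : w.length * (n + 3) + 1 + 1 ≤ _)
    · simpa [feedback] using ReachesIn.head (step_mix_cons k e I a b u w f g) hr
    · rw [List.length_cons, Nat.succ_mul]
      omega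

theorem reachesIn_clearFront (I : List (Bool ⊕ Bool)) (u w g : List Bool) : ∀ f : List Bool,
    ReachesIn (extStep k e) (f.length + 1) (prepCfg k e .clearFront 0 I u w f g)
      (prepCfg k e .clearBack 0 I u w [] g)
  | [] => .single (step_clearFront_nil k e I u w g)
  | b :: f => .head (step_clearFront_cons k e I b u w f g) (reachesIn_clearFront I u w g f)

theorem reachesIn_clearBack (I : List (Bool ⊕ Bool)) (u w f : List Bool) : ∀ g : List Bool,
    ReachesIn (extStep k e) (g.length + 1) (prepCfg k e .clearBack 0 I u w f g)
      (prepCfg k e .unload 0 I u w f [])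
  | [] => .single (step_clearBack_nil k e I u w f)
  | b :: g => .head (step_clearBack_cons k e I b u w f g) (reachesIn_clearBack I u w f g)

theorem reachesIn_unload : ∀ (u : List Bool) (I : List (Bool ⊕ Bool)),
    ReachesIn (extStep k e) (u.length + 1) (prepCfg k e .unload 0 I u [] [] [])
      (liftCfg k ⟨some tm.main, tm.initialState, inputStk e (u.reverse.map .inl ++ I)⟩)
  | [], I => .single (step_unload_nil k e I)
  | b :: u, I => by
    simpa using ReachesIn.head (step_unload_cons k e I b u [] [] [])
      (reachesIn_unload u (.inl b :: I))

/-- The input that the extended machine prepares. -/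
def prepare (k : ℕ) (x : List Bool × List Bool) : List Bool × List Bool :=
  (feedback (extract k x.1.length 0 x.2).1.reverse x.1, (extract k x.1.length 0 x.2).2)

theorem length_feedback_le : ∀ q w : List Bool, (feedback q w).length ≤ w.length
  | _, [] => by simp
  | [], _ :: _ => by simp [feedback]
  | a :: q, b :: w => by simpa [feedback] using length_feedback_le (q ++ [xor a b]) w

theorem reachesIn_prepare (x : List Bool × List Bool) :
    ReachesIn (extStep k e) (x.1.length ^ 2 + 7 * x.1.length + 6)
      (prepCfg k e .readWord 0 (x.1.map .inl ++ x.2.map .inr) [] [] [] [])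
      (liftCfg k ⟨some tm.main, tm.initialState,
        inputStk e ((prepare k x).1.map .inl ++ (prepare k x).2.map .inr)⟩) := by
  obtain ⟨w, r⟩ := x
  have h₁ := reachesIn_readWord k e r w []
  have h₂ := reachesIn_sample k e w.reverse [] [] r 0
  simp only [List.append_nil, List.reverse_reverse, List.length_reverse, Fin.val_zero] at h₁ h₂
  -- The counter starts at `0`, so the first toss is always kept.
  have hq : w = [] ∨ (extract k w.length 0 r).1.length ≠ 0 := by
    cases w <;> simp [extract]
  obtain ⟨f, g, hfg, h₃⟩ := reachesIn_mix k e ((extract k w.length 0 r).2.map .inr)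
    (extract k w.length 0 r).1.length w [] (extract k w.length 0 r).1.reverse [] (by simp) hq
  have hle := length_extract_fst_le k w.length 0 r
  simp only [List.append_nil, List.reverse_nil] at h₃
  have h₄ := reachesIn_clearFront k e ((extract k w.length 0 r).2.map .inr)
    (feedback (extract k w.length 0 r).1.reverse w).reverse [] g f
  have h₅ := reachesIn_clearBack k e ((extract k w.length 0 r).2.map .inr)
    (feedback (extract k w.length 0 r).1.reverse w).reverse [] [] g
  have h₆ := reachesIn_unload k e (feedback (extract k w.length 0 r).1.reverse w).reverse
    ((extract k w.length 0 r).2.map .inr)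
  have hfb := length_feedback_le (extract k w.length 0 r).1.reverse w
  rw [List.reverse_reverse, List.length_reverse] at h₆
  -- The coefficient 7: three from mixing, one each from reading, sampling and unloading, and one
  -- from clearing a register no longer than `w`.
  refine ((((((h₁.trans h₂).trans h₃).trans h₄).trans h₅).trans h₆)).mono ?_
  have := Nat.mul_le_mul_left w.length (Nat.add_le_add_right hle 3)
  have : w.length * (w.length + 3) = w.length ^ 2 + 3 * w.length := by ring
  simp only
  omega

theorem initList_extend (s : List (Bool ⊕ Bool)) :
    initList (extend k e) (s.map e.symm) = prepCfg k e .readWord 0 s [] [] [] [] := by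
  unfold initList prepCfg
  congr 1
  funext i
  rcases i with i | i
  · by_cases h : i = tm.k₀
    · subst h
      simp [extend, joinStk, inputStk]
      rfl
    · simp [extend, joinStk, inputStk, h]
  · cases i <;> simp [extend, joinStk, workStk]

theorem initList_eq (s : List (Bool ⊕ Bool)) :
    initList tm (s.map e.symm) = ⟨some tm.main, tm.initialState, inputStk e s⟩ := by
  unfold initList
  congr 1
  funext i
  by_cases h : i = tm.k₀
  · subst h
    simp [inputStk]
  · simp [inputStk, h]

theorem haltList_extend (s : List (tm.Γ tm.k₁)) :
    haltList (extend k e) s = liftCfg k (haltList tm s) := by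
  unfold haltList liftCfg
  congr 1
  funext i
  rcases i with i | i
  · by_cases h : i = tm.k₁
    · subst h
      simp [extend, joinStk]
      rfl
    · simp [extend, joinStk, h]
  · simp [extend, joinStk]

theorem eval_mono_nat (p : Polynomial ℕ) : Monotone fun n : ℕ => p.eval n := by
  intro m n h
  simp only [Polynomial.eval_eq_sum, Polynomial.sum_def]
  gcongr

/-- A polynomial-time predicate stays so when its input is prepared by `prepare`. -/
theorem polyTime_comp_prepare {φ : List Bool × List Bool → Bool}
    (h : Nonempty (TM2ComputableInPolyTime
      (encodingProd (encodingList Bool) (encodingList Bool)).encode encodeBool φ)) :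
    Nonempty (TM2ComputableInPolyTime
      (encodingProd (encodingList Bool) (encodingList Bool)).encode encodeBool
      (φ ∘ prepare k)) := by
  obtain ⟨M⟩ := h
  have key : ∀ x : List Bool × List Bool,
      Nonempty (TM2OutputsInTime (extend k M.inputAlphabet)
        (((encodingProd (encodingList Bool) (encodingList Bool)).encode x).map
          M.inputAlphabet.symm)
        (some ((encodeBool (φ (prepare k x))).map M.outputAlphabet.symm))
        ((Polynomial.X ^ 2 + 7 * Polynomial.X + 6 + M.time).eval
          ((encodingProd (encodingList Bool) (encodingList Bool)).encode x).length)) := by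
    intro x
    have h₁ := reachesIn_prepare k M.inputAlphabet x
    have h₂ : ReachesIn (TM2.step M.tm.m) _ _ _ := ⟨M.outputsFun (prepare k x)⟩
    have h₃ := h₂.map (liftCfg k) (step_liftCfg k M.inputAlphabet)
    rw [← haltList_extend k M.inputAlphabet] at h₃
    change ReachesIn _ _ (liftCfg k (initList M.tm (List.map M.inputAlphabet.symm
      ((prepare k x).1.map .inl ++ (prepare k x).2.map .inr)))) _ at h₃
    rw [initList_eq] at h₃
    have h₄ := h₁.trans h₃
    rw [← initList_extend] at h₄
    refine h₄.mono ?_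
    have hlen : ∀ y : List Bool × List Bool,
        ((encodingProd (encodingList Bool) (encodingList Bool)).encode y).length =
          y.1.length + y.2.length := by
      intro y; simp [encodingProd, encodingList]
    rw [hlen, hlen]
    -- Preparation does not lengthen the input, so the old time bound may be taken at the original
    -- length.
    have hle : (prepare k x).1.length + (prepare k x).2.length ≤ x.1.length + x.2.length :=
      Nat.add_le_add (length_feedback_le _ _) (length_extract_snd_le _ _ _ _)
    have hmono := eval_mono_nat M.time hle
    simp only [Polynomial.eval_add, Polynomial.eval_mul, Polynomial.eval_pow, Polynomial.eval_X,
      Polynomial.eval_ofNat] at hmono ⊢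
    have : x.1.length ^ 2 ≤ (x.1.length + x.2.length) ^ 2 := Nat.pow_le_pow_left (by omega) 2
    omega
  exact ⟨{
    tm := extend k M.inputAlphabet
    inputAlphabet := M.inputAlphabet
    outputAlphabet := M.outputAlphabet
    time := Polynomial.X ^ 2 + 7 * Polynomial.X + 6 + M.time
    outputsFun := fun x => (key x).some }⟩

end Machine

/-! ### The reduction -/

section Reduction

/-- The distinguisher that fills a shift register with coin tosses, feeds its input into it, and
runs `D` on the output. -/
noncomputable def PPT.reduce (k : ℕ) (D : PPT) : PPT where
  -- The register needs only `N` tosses, but `N` is no polynomial with natural coefficients in the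
  -- input length `(k + 1) * N`; hence one toss per input bit.
  coins := Polynomial.X + D.coins
  verdict := D.verdict ∘ prepare k
  polyTime := polyTime_comp_prepare k D.polyTime

theorem PPT.run_reduce {k N : ℕ} (D : PPT) (hN : 0 < N) {w : List Bool}
    (hw : w.length = (k + 1) * N) :
    (D.reduce k).run w = (uniformBits N).bind fun y => D.run (feedback y w) := by
  -- Stacking the kept tosses reverses them, which does not affect their distribution.
  have hrev : (uniformBits N).map List.reverse = uniformBits N :=
    uniformBits_map_of_injOn (by simp) (List.reverse_injective.injOn)
  have hcoins : (D.reduce k).coins.eval w.length = (k + 1) * N + D.coins.eval w.length := by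
    simp [PPT.reduce, hw]
  rw [PPT.run, hcoins, ← PMF.bind_pure_comp]
  have h := uniformBits_bind_extract k (D.coins.eval w.length) N
    fun y r => PMF.pure (D.verdict (feedback y.reverse w, r))
  rw [← hw] at h ⊢
  refine h.trans ?_
  conv_rhs => rw [← hrev, PMF.bind_map]
  refine uniformBits_bind_congr fun y hy => ?_
  -- The number of coins of `D` depends on the length of its input.
  have hlen : (feedback y.reverse w).length = w.length := by
    refine length_feedback _ _ ?_
    rintro h0
    rw [List.reverse_eq_nil_iff] at h0
    simp [h0] at hy
    omega
  rw [Function.comp_apply, PPT.run, hlen]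
  rfl

/-- On a uniform input the reduction behaves as `D` does. -/
theorem PPT.acceptProb_reduce_uniformBits (k : ℕ) {N : ℕ} (D : PPT) (hN : 0 < N) :
    (D.reduce k).acceptProb (uniformBits ((k + 1) * N)) =
      D.acceptProb (uniformBits ((k + 1) * N)) := by
  unfold PPT.acceptProb
  congr 2
  -- Draw `y` first: for fixed `y` the feedback map permutes the strings of the given length.
  rw [uniformBits_bind_congr fun w hw => D.run_reduce hN hw, PMF.bind_comm]
  rw [← PMF.bind_const (uniformBits N) ((uniformBits ((k + 1) * N)).bind D.run)]
  refine uniformBits_bind_congr fun y hy => ?_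
  have hy0 : y ≠ [] := by
    rintro rfl
    simp at hy
    omega
  have h : (uniformBits ((k + 1) * N)).map (feedback y) = uniformBits ((k + 1) * N) :=
    uniformBits_map_of_injOn (fun w hw => (length_feedback y w hy0).trans hw)
      fun u _ v _ huv => feedback_injective y u v hy0 huv
  conv_rhs => rw [← h, PMF.bind_map]
  rfl

/-- On an output of `H` the reduction behaves as `D` does on an output of the generator. -/
theorem PPT.acceptProb_reduce_map (k : ℕ) {N : ℕ} (D : PPT) (hN : 0 < N)
    {H : List Bool → List Bool} (hH : ∀ S : List Bool, S.length = N → (H S).length = (k + 1) * N) :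
    (D.reduce k).acceptProb ((uniformBits N).map H) =
      D.acceptProb ((uniformBits (N + N)).map (xorGenerator (k + 1) H)) := by
  unfold PPT.acceptProb
  congr 2
  rw [PMF.bind_map, PMF.bind_map, uniformBits_add_bind, PMF.bind_comm]
  refine uniformBits_bind_congr fun S hS => ?_
  rw [Function.comp_apply, D.run_reduce hN (hH S hS)]
  -- With `S` fixed, xor with `S` is an involution, so x₀ ⊕ S₀ can replace the freshly drawn
  -- register.
  have h : (uniformBits N).map (xorStr · S) = uniformBits N := by
    refine uniformBits_map_of_injOn
      (fun x hx => (length_xorStr (hx.trans hS.symm)).trans hS) fun x hx x' hx' hxx => ?_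
    rw [← xorStr_cancel (Eq.trans hx hS.symm), ← xorStr_cancel (Eq.trans hx' hS.symm)]
    exact congrArg (xorStr · S) hxx
  conv_lhs => rw [← h, PMF.bind_map]
  refine uniformBits_bind_congr fun x hx => ?_
  rw [Function.comp_apply, Function.comp_apply, xorGenerator_append hx hS (hH S hS)]

end Reduction

/-! ### The generator property and security -/

theorem isPRNG_xorGenerator {k : ℕ} (hk : 2 < k) {H : List Bool → List Bool}
    (hH : IsPRNG {N | 0 < N} (fun N => k * N) H) :
    IsPRNG {m | 0 < m ∧ Even m} (fun m => k * (m / 2)) (xorGenerator k H) where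
  computable := computable_xorGenerator k hH.computable
  infinite := Set.infinite_of_injective_forall_mem (f := fun n : ℕ => 2 * (n + 1))
    (fun a b h => by simpa using h) fun n => ⟨by simp, even_two_mul _⟩
  length_eq := by
    rintro s ⟨hs, N, hN⟩
    have hx : (s.take N).length = N := by rw [List.length_take]; omega
    have hS : (s.drop N).length = N := by rw [List.length_drop]; omega
    have hHS : (H (s.drop N)).length = k * N := by
      rw [hH.length_eq _ (by rw [hS]; exact (by omega : 0 < N)), hS]
    have hne : xorStr (s.take N) (s.drop N) ≠ [] := by
      intro h
      have := length_xorStr (hx.trans hS.symm)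
      rw [h, hS, List.length_nil] at this
      omega
    have h := xorGenerator_append hx hS hHS
    rw [List.take_append_drop] at h
    rw [h, length_feedback _ _ hne, hHS]
    congr 1
    omega
  stretch := by
    rintro m ⟨hm, N, rfl⟩
    have : (N + N) / 2 = N := by omega
    rw [this]
    have : 3 * N ≤ k * N := Nat.mul_le_mul_right N hk
    omega

theorem isSecure_xorGenerator {k : ℕ} {H : List Bool → List Bool}
    (hH : IsPRNG {N | 0 < N} (fun N => (k + 1) * N) H)
    (hs : IsSecure {N | 0 < N} (fun N => (k + 1) * N) H) :
    IsSecure {m | 0 < m ∧ Even m} (fun m => (k + 1) * (m / 2)) (xorGenerator (k + 1) H) := by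
  intro D p hp
  -- Seeds of `H` are half as long, so security of `H` is used with p(2n).
  have hcomp : ∀ n : ℕ, (p.comp (2 * Polynomial.X)).eval (n : ℝ) = p.eval ((n + n : ℕ) : ℝ) := by
    intro n
    simp [two_mul]
  have h := hs (D.reduce k) (p.comp (2 * Polynomial.X)) fun n => by
    rw [hcomp]
    exact hp (n + n)
  obtain ⟨N₀, hN₀⟩ := eventually_atTop.1 h
  refine eventually_atTop.2 ⟨2 * N₀, ?_⟩
  rintro m hm ⟨hm0, N, rfl⟩
  have hN : 0 < N := by omega
  have hN' := hN₀ N (by omega) hN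
  have hhalf : (N + N) / 2 = N := by omega
  simp only [hhalf]
  rw [hcomp, D.acceptProb_reduce_map k hN fun S hS => by
    rw [hH.length_eq S (by rw [hS]; exact hN), hS],
    D.acceptProb_reduce_uniformBits k hN] at hN'
  exact hN'

end XorPRNG

theorem mainTheorem2 (k : ℕ) (hk : 2 < k) (H : List Bool → List Bool)
    (hH : XorPRNG.IsSecurePRNG {N | 0 < N} (fun N => k * N) H) :
    XorPRNG.IsSecurePRNG {m | 0 < m ∧ Even m} (fun m => k * (m / 2))
      (XorPRNG.xorGenerator k H) := by
  refine ⟨XorPRNG.isPRNG_xorGenerator hk hH.1, ?_⟩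
  -- The counter takes the values `0, …, j`, so its period is `j + 1`.
  obtain ⟨k, rfl⟩ : ∃ j, k = j + 1 := ⟨k - 1, by omega⟩
  exact XorPRNG.isSecure_xorGenerator hH.1 hH.2
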